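/- Let $(R,\mathfrak m)$ be a commutative Noetherian local ring, and let $M$ and $N$ be finitely generated $R$-modules with $N\neq 0$. Suppose that $N$ has finite injective dimension and that $\operatorname{depth} N\ge \dim R-1$, where $\operatorname{depth} N$ is the length of a maximal $N$-regular sequence in $\mathfrak m$ and $\dim R$ is the Krull dimension of $R$. If $\operatorname{Ext}^i_R(M,N)$ has finite injective dimension over $R$ for every $i\ge 0$, then $M$ has finite projective dimension over $R$. (The zero module is regarded as having finite injective and projective dimension.) -/

import Mathlib

universe u

/-- The depth of a module `N` over a local ring `R`: the supremum of the lengths of the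
`N`-regular sequences contained in the maximal ideal. If `N` is finitely generated and nonzero,
the condition `N ≠ (x₁, …, xₙ) N` on a regular sequence in the maximal ideal is automatic
(see `isRegular_of_isWeaklyRegular_of_mem_maximalIdeal`), and it is left out so that the
zero module has depth `⊤`, as usual. -/
noncomputable def moduleDepth (R : Type*) [CommRing R] [IsLocalRing R]
    (N : Type*) [AddCommGroup N] [Module R N] : ℕ∞ :=
  ⨆ (rs : List R) (_ : RingTheory.Sequence.IsWeaklyRegular N rs ∧
    ∀ r ∈ rs, r ∈ IsLocalRing.maximalIdeal R), (rs.length : ℕ∞)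

theorem isRegular_of_isWeaklyRegular_of_mem_maximalIdeal {R : Type*} [CommRing R] [IsLocalRing R]
    {N : Type*} [AddCommGroup N] [Module R N] [Module.Finite R N] [Nontrivial N] {rs : List R}
    (h : RingTheory.Sequence.IsWeaklyRegular N rs)
    (hmem : ∀ r ∈ rs, r ∈ IsLocalRing.maximalIdeal R) :
    RingTheory.Sequence.IsRegular N rs := by
  refine ⟨h, fun htop => ?_⟩
  have hle : Ideal.ofList rs ≤ IsLocalRing.maximalIdeal R :=
    Ideal.span_le.mpr fun r hr => hmem r hr
  have hbot : (⊤ : Submodule R N) = ⊥ :=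
    Submodule.eq_bot_of_le_smul_of_le_jacobson_bot (Ideal.ofList rs) ⊤ Module.Finite.fg_top
      htop.le (hle.trans (IsLocalRing.maximalIdeal_le_jacobson ⊥))
  exact top_ne_bot hbot

/-! Write k for the residue field. The principle behind the proof is that the Bass series of RHom(M,
N) is the Poincaré series of M times the Bass series of N. Since N is finitely generated and
nonzero, some Ext^i(k, N) is nonzero (`exists_nontrivial_ext_residueField`), so finite injective
dimension of RHom(M, N) leaves M only finitely many nonzero Betti numbers.

The product formula is replaced by a direct argument, valid when Ext^i(M, N) = 0 for all i > 0. Let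
F be a minimal free resolution of M and E an injective resolution of N. The total complex of Hom(F,
E) is then an injective resolution of Hom(M, N), so its cycles are injective in high degrees.
Splitting them off, every cycle of higher degree killed by the maximal ideal bounds a family killed
by the maximal ideal. On such families minimality of F kills the part of the differential coming
from F, so if no F_j vanished, every socle element of a cosyzygy of N would lift to the socle of the
preceding injective, contradicting `CosyzygySequence.exists_socle_element`. This is
`HomComplex.exists_betti_eq_zero`.

The general case reduces to this one: Ext^i(M, N) vanishes for large i because N has finite
injective dimension, and replacing M by a syzygy shifts the vanishing down by one while keeping all
Ext modules of finite injective dimension. -/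

open CategoryTheory Abelian IsLocalRing

/-! ### Nonvanishing of Ext from the residue field. -/

section ExtVanishing

variable {R : Type u} [CommRing R]

lemma subsingleton_ext_of_shortExact {S : ShortComplex (ModuleCat.{u} R)} (hS : S.ShortExact)
    (N : ModuleCat.{u} R) (i : ℕ) (h₁ : Subsingleton (Ext.{u} S.X₁ N i))
    (h₃ : Subsingleton (Ext.{u} S.X₃ N i)) : Subsingleton (Ext.{u} S.X₂ N i) := by
  refine subsingleton_of_forall_eq 0 fun x => ?_
  obtain ⟨y, rfl⟩ := Ext.contravariant_sequence_exact₂ hS N x (Subsingleton.elim _ _)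
  rw [Subsingleton.elim y 0, Ext.comp_zero]

/-- If every `Ext` group out of the cokernel of a non-unit `x` vanishes, so does every `Ext` group
out of a module on which `x` is a nonzerodivisor. -/
lemma subsingleton_ext_of_isSMulRegular [IsLocalRing R] [IsNoetherianRing R]
    (N L : ModuleCat.{u} R) [Module.Finite R N] [Module.Finite R L] (x : R)
    (hx : x ∈ maximalIdeal R) (hreg : IsSMulRegular L x)
    (h : ∀ i, Subsingleton (Ext.{u} (ModuleCat.of R (L ⧸ LinearMap.range (LinearMap.lsmul R L x)))
      N i)) (i : ℕ) :
    Subsingleton (Ext.{u} L N i) := by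
  let S := ModuleCat.shortComplexOfCompEqZero _ _
    (LinearMap.lsmul R L x).exact_map_mkQ_range.linearMap_comp_eq_zero
  have hS : S.ShortExact := ModuleCat.shortComplex_shortExact S
    (LinearMap.lsmul R L x).exact_map_mkQ_range hreg (Submodule.mkQ_surjective _)
  have hf : S.f = x • 𝟙 L := by ext; rfl
  -- As Ext^{i+1}(L/xL, N) = 0, multiplication by x is onto on Ext^i(L, N), and Nakayama applies.
  have htop : (⊤ : Submodule R (Ext.{u} L N i)) ≤ maximalIdeal R • ⊤ := by
    intro e _
    have := h (1 + i)
    obtain ⟨e', he'⟩ := Ext.contravariant_sequence_exact₁ hS N (n₀ := i) e rfl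
      (Subsingleton.elim _ _)
    rw [hf, Ext.mk₀_smul, Ext.smul_comp, Ext.mk₀_id_comp] at he'
    rw [← he']
    exact Submodule.smul_mem_smul hx trivial
  have := Submodule.eq_bot_of_le_smul_of_le_jacobson_bot (maximalIdeal R) _
    Module.Finite.fg_top htop (maximalIdeal_le_jacobson ⊥)
  exact (Submodule.subsingleton_iff R).mp (subsingleton_of_bot_eq_top this.symm)

/-- Noetherian induction on J combined with prime filtrations. For L = R/p with p not maximal, some
x in the maximal ideal is regular on L, and L/xL is killed by the strictly larger ideal J + (x). -/
lemma subsingleton_ext_of_le_annihilator [IsLocalRing R] [IsNoetherianRing R]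
    (N : ModuleCat.{u} R) [Module.Finite R N]
    (h : ∀ i, Subsingleton (Ext.{u} (ModuleCat.of R (R ⧸ maximalIdeal R)) N i)) (J : Ideal R) :
    ∀ (L : Type u) [AddCommGroup L] [Module R L] [Module.Finite R L],
      J ≤ Module.annihilator R L → ∀ i, Subsingleton (Ext.{u} (ModuleCat.of R L) N i) := by
  induction J using WellFoundedGT.induction with
  | ind J ih =>
  intro L _ _ hL
  induction hL using IsNoetherianRing.induction_on_isQuotientEquivQuotientPrime R with
  | subsingleton L =>
    intro _ i
    refine subsingleton_of_forall_eq 0 fun x => ?_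
    have hz : 𝟙 (ModuleCat.of R L) = 0 := by ext a; exact Subsingleton.elim (α := L) _ _
    rw [← Ext.mk₀_id_comp x, hz, Ext.mk₀_zero, Ext.zero_comp]
  | quotient L p e =>
    intro hJ i
    by_cases hp : maximalIdeal R ≤ p.1
    · have hpm : p.1 = maximalIdeal R := le_antisymm (le_maximalIdeal p.2.ne_top) hp
      let e' := e.trans (Submodule.quotEquivOfEq _ _ hpm)
      refine subsingleton_of_forall_eq 0 fun x => ?_
      have := h i
      have hz : (Ext.mk₀ e'.toModuleIso.inv).comp x (zero_add i) = 0 := Subsingleton.elim _ _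
      rw [← Ext.mk₀_id_comp x, ← e'.toModuleIso.hom_inv_id, ← Ext.mk₀_comp_mk₀,
        Ext.comp_assoc_of_second_deg_zero, hz, Ext.comp_zero]
    · obtain ⟨x, hx, hxp⟩ := SetLike.not_le_iff_exists.mp hp
      refine subsingleton_ext_of_isSMulRegular N (ModuleCat.of R L) x hx ?_ ?_ i
      · intro a b hab
        apply e.injective
        have hab' : e (x • a) = e (x • b) := congrArg e hab
        rw [map_smul, map_smul, Algebra.smul_def, Algebra.smul_def] at hab'
        exact mul_left_cancel₀ (fun h0 => hxp (Ideal.Quotient.eq_zero_iff_mem.mp h0)) hab'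
      · have hJp : J ≤ p.1 := by
          rw [e.annihilator_eq, Ideal.annihilator_quotient] at hJ
          exact hJ
        refine ih (J ⊔ Ideal.span {x}) ?_ _ (sup_le ?_ ?_)
        · refine lt_of_le_of_ne le_sup_left fun h0 => hxp (hJp ?_)
          rw [h0]
          exact Ideal.mem_sup_right (Ideal.mem_span_singleton_self x)
        · exact hJ.trans (LinearMap.annihilator_le_of_surjective _ (Submodule.mkQ_surjective _))
        · rw [Ideal.span_singleton_le_iff_mem, Module.mem_annihilator]
          intro m
          obtain ⟨a, rfl⟩ := Submodule.mkQ_surjective _ m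
          rw [← map_smul]
          exact (Submodule.Quotient.mk_eq_zero _).mpr ⟨a, rfl⟩
  | exact L₁ L₂ L₃ f g hf hg hfg h₁ h₃ =>
    intro hJ i
    exact subsingleton_ext_of_shortExact (S := ModuleCat.shortComplexOfCompEqZero f g
      hfg.linearMap_comp_eq_zero) (ModuleCat.shortComplex_shortExact _ hfg hf hg) N i
      (h₁ (hJ.trans (LinearMap.annihilator_le_of_injective f hf)) i)
      (h₃ (hJ.trans (LinearMap.annihilator_le_of_surjective g hg)) i)

/-- A nonzero finitely generated module over a Noetherian local ring has a nonzero Bass number. -/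
lemma exists_nontrivial_ext_residueField [IsLocalRing R] [IsNoetherianRing R]
    (N : ModuleCat.{u} R) [Module.Finite R N] [Nontrivial N] :
    ∃ i, Nontrivial (Ext.{u} (ModuleCat.of R (R ⧸ maximalIdeal R)) N i) := by
  by_contra! h
  have h0 := subsingleton_ext_of_le_annihilator N h ⊥ R bot_le 0
  have e := (Ext.linearEquiv₀ (R := R) (X := ModuleCat.of R R) (Y := N)).trans
    (ModuleCat.homLinearEquiv.trans (LinearMap.ringLmapEquivSelf R R N))
  exact not_subsingleton N e.symm.subsingleton

end ExtVanishing

/-! ### Injective and minimal free resolutions, cut into short exact sequences. -/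

section Resolutions

variable {R : Type u} [CommRing R]

/-- An injective resolution, recorded together with its cosyzygy modules
`0 → N q → I q → N (q + 1) → 0`. -/
structure CosyzygySequence (R : Type u) [CommRing R] where
  N : ℕ → ModuleCat.{u} R
  I : ℕ → ModuleCat.{u} R
  ι : ∀ q, N q →ₗ[R] I q
  π : ∀ q, I q →ₗ[R] N (q + 1)
  injective_ι : ∀ q, Function.Injective (ι q)
  exact : ∀ q, Function.Exact (ι q) (π q)
  surjective_π : ∀ q, Function.Surjective (π q)
  injective : ∀ q, Module.Injective R (I q)

namespace CosyzygySequence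

lemma exists_injective_presentation (X : ModuleCat.{u} R) :
    ∃ (I Y : ModuleCat.{u} R) (ι : X →ₗ[R] I) (π : I →ₗ[R] Y), Function.Injective ι ∧
      Function.Exact ι π ∧ Function.Surjective π ∧ Module.Injective R I := by
  let P := (EnoughInjectives.presentation X).some
  have := P.injective
  have := P.mono
  exact ⟨P.J, ModuleCat.of R (P.J ⧸ LinearMap.range P.f.hom), P.f.hom, Submodule.mkQ _,
    (ModuleCat.mono_iff_injective _).mp P.mono, P.f.hom.exact_map_mkQ_range,
    Submodule.mkQ_surjective _, Module.injective_module_of_injective_object R P.J⟩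

lemma exists_zero_eq (X : ModuleCat.{u} R) : ∃ C : CosyzygySequence R, C.N 0 = X := by
  choose I Y ι π h using exists_injective_presentation (R := R)
  let N : ℕ → ModuleCat.{u} R := fun n => Nat.rec X (fun _ Z => Y Z) n
  exact ⟨⟨N, fun q => I (N q), fun q => ι (N q), fun q => π (N q), fun q => (h _).1,
    fun q => (h _).2.1, fun q => (h _).2.2.1, fun q => (h _).2.2.2⟩, rfl⟩

variable (C : CosyzygySequence R)

/-- The short complex `N q → I q → N (q + 1)`. -/
noncomputable abbrev shortComplex (q : ℕ) : ShortComplex (ModuleCat.{u} R) :=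
  ModuleCat.shortComplexOfCompEqZero (C.ι q) (C.π q) (C.exact q).linearMap_comp_eq_zero

lemma shortExact (q : ℕ) : (C.shortComplex q).ShortExact :=
  ModuleCat.shortComplex_shortExact _ (C.exact q) (C.injective_ι q) (C.surjective_π q)

lemma injective_object (q : ℕ) : Injective (C.shortComplex q).X₂ :=
  have := C.injective q
  Module.injective_object_of_injective_module R (C.I q)

lemma subsingleton_ext (X : ModuleCat.{u} R)
    (h : ∀ i, Subsingleton (Ext.{u} X (C.N 0) (i + 1))) (q i : ℕ) :
    Subsingleton (Ext.{u} X (C.N q) (i + 1)) := by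
  induction q generalizing i with
  | zero => exact h i
  | succ q ih =>
    refine subsingleton_of_forall_eq 0 fun x => ?_
    have := ih (i + 1)
    have := C.injective_object q
    obtain ⟨y, rfl⟩ := Ext.covariant_sequence_exact₃ X (C.shortExact q) x rfl
      (Subsingleton.elim _ _)
    rw [Ext.eq_zero_of_injective y, Ext.zero_comp]

/-- The obstruction to lifting lies in Ext^1(X, N q), which vanishes by dimension shifting. -/
lemma exists_lift (X : ModuleCat.{u} R)
    (h : ∀ i, Subsingleton (Ext.{u} X (C.N 0) (i + 1))) (q : ℕ) (φ : X →ₗ[R] C.N (q + 1)) :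
    ∃ ψ : X →ₗ[R] C.I q, C.π q ∘ₗ ψ = φ := by
  have := C.subsingleton_ext X h q 0
  obtain ⟨y, hy⟩ := Ext.covariant_sequence_exact₃ X (C.shortExact q)
    (Ext.mk₀ (ModuleCat.ofHom φ)) (n₁ := 1) rfl (Subsingleton.elim _ _)
  obtain ⟨ψ, rfl⟩ := (Ext.mk₀_bijective X _).surjective y
  rw [Ext.mk₀_comp_mk₀] at hy
  refine ⟨ψ.hom, ?_⟩
  exact congrArg ModuleCat.Hom.hom ((Ext.mk₀_bijective X _).injective hy)

lemma subsingleton_ext_of_exists_lift (X : ModuleCat.{u} R)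
    (h : ∀ q (φ : X →ₗ[R] C.N (q + 1)), ∃ ψ : X →ₗ[R] C.I q, C.π q ∘ₗ ψ = φ) (q i : ℕ) :
    Subsingleton (Ext.{u} X (C.N q) (i + 1)) := by
  induction i generalizing q with
  | zero =>
    refine subsingleton_of_forall_eq 0 fun x => ?_
    have := C.injective_object q
    obtain ⟨y, rfl⟩ := Ext.covariant_sequence_exact₁ X (C.shortExact q) x
      (Ext.eq_zero_of_injective _) rfl
    obtain ⟨φ, rfl⟩ := (Ext.mk₀_bijective X _).surjective y
    obtain ⟨ψ, hψ⟩ := h q φ.hom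
    have : φ = ModuleCat.ofHom ψ ≫ (C.shortComplex q).g := by
      ext x
      exact (LinearMap.congr_fun hψ x).symm
    rw [this, ← Ext.mk₀_comp_mk₀, Ext.comp_assoc_of_second_deg_zero,
      ShortComplex.ShortExact.comp_extClass, Ext.comp_zero]
  | succ i ih =>
    refine subsingleton_of_forall_eq 0 fun x => ?_
    have := C.injective_object q
    obtain ⟨y, rfl⟩ := Ext.covariant_sequence_exact₁ X (C.shortExact q) x
      (Ext.eq_zero_of_injective _) rfl
    have := ih (q + 1)
    rw [Subsingleton.elim y 0, Ext.zero_comp]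

/-- Among the cosyzygies of a nonzero finitely generated module there is a socle element that does
not lift to the socle of the preceding injective module. -/
lemma exists_socle_element [IsLocalRing R] [IsNoetherianRing R] [Module.Finite R (C.N 0)]
    [Nontrivial (C.N 0)] :
    (∃ v : C.N 0, v ≠ 0 ∧ ∀ r ∈ maximalIdeal R, r • v = 0) ∨
    ∃ (q : ℕ) (v : C.N (q + 1)), (∀ r ∈ maximalIdeal R, r • v = 0) ∧
      ∀ y : C.I q, (∀ r ∈ maximalIdeal R, r • y = 0) → C.π q y ≠ v := by
  by_contra! hcon
  obtain ⟨h0, h1⟩ := hcon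
  let k := ModuleCat.of R (R ⧸ maximalIdeal R)
  -- Maps out of k correspond to socle elements via the image of 1, so the negated claim forces
  -- every Ext^i(k, N 0) to vanish.
  have hk : ∀ {Z : ModuleCat.{u} R} (φ : k →ₗ[R] Z), ∀ r ∈ maximalIdeal R,
      r • φ (Submodule.Quotient.mk 1) = 0 := fun φ r hr => by
    rw [← map_smul, ← Submodule.Quotient.mk_smul, smul_eq_mul, mul_one,
      (Submodule.Quotient.mk_eq_zero _).mpr hr, map_zero]
  have hext : ∀ {Z : ModuleCat.{u} R} (φ ψ : k →ₗ[R] Z),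
      φ (Submodule.Quotient.mk 1) = ψ (Submodule.Quotient.mk 1) → φ = ψ := fun φ ψ h => by
    refine Submodule.linearMap_qext _ (LinearMap.ext_ring ?_)
    exact h
  obtain ⟨i, hi⟩ := exists_nontrivial_ext_residueField (C.N 0)
  refine not_subsingleton_iff_nontrivial.mpr hi ?_
  cases i with
  | zero =>
    refine subsingleton_of_forall_eq 0 fun x => ?_
    obtain ⟨φ, rfl⟩ := (Ext.mk₀_bijective k _).surjective x
    have : φ = 0 := by
      refine ModuleCat.hom_ext (hext _ _ ?_)
      by_contra hne
      obtain ⟨r, hr, hne'⟩ := h0 (φ.hom (Submodule.Quotient.mk 1)) hne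
      exact hne' (hk φ.hom r hr)
    rw [this, Ext.mk₀_zero]
  | succ i =>
    refine C.subsingleton_ext_of_exists_lift k (fun q φ => ?_) 0 i
    obtain ⟨y, hy, hyv⟩ := h1 q (φ (Submodule.Quotient.mk 1)) (hk φ)
    refine ⟨Submodule.liftQ _ (LinearMap.toSpanSingleton R _ y) fun r hr => ?_, hext _ _ ?_⟩
    · exact LinearMap.mem_ker.mpr (hy r hr)
    · rw [← hyv, LinearMap.comp_apply]
      exact congrArg (C.π q) (one_smul R y)

end CosyzygySequence

/-- A minimal free resolution, recorded together with its syzygy modules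
`0 → M (j + 1) → R ^ b j → M j → 0`. -/
structure MinimalSyzygySequence (R : Type u) [CommRing R] [IsLocalRing R] where
  M : ℕ → ModuleCat.{u} R
  b : ℕ → ℕ
  ι : ∀ j, M (j + 1) →ₗ[R] (Fin (b j) → R)
  π : ∀ j, (Fin (b j) → R) →ₗ[R] M j
  injective_ι : ∀ j, Function.Injective (ι j)
  exact : ∀ j, Function.Exact (ι j) (π j)
  surjective_π : ∀ j, Function.Surjective (π j)
  minimal : ∀ j x i, ι j x i ∈ maximalIdeal R

namespace MinimalSyzygySequence

-- Lift a basis of k ⊗ M: Nakayama makes the lifts generate, and any relation reduces to one among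
-- basis vectors, so its coefficients lie in the maximal ideal.
open TensorProduct in
lemma exists_minimal_cover [IsLocalRing R] (M : Type u) [AddCommGroup M] [Module R M]
    [Module.Finite R M] :
    ∃ (b : ℕ) (π : (Fin b → R) →ₗ[R] M), Function.Surjective π ∧
      ∀ x, π x = 0 → ∀ i, x i ∈ maximalIdeal R := by
  let k := ResidueField R
  let B := Module.finBasis k (k ⊗[R] M)
  choose v hv using fun i => TensorProduct.mk_surjective R M k Ideal.Quotient.mk_surjective (B i)
  have hspan := span_eq_top_of_tmul_eq_basis v B hv
  refine ⟨_, Fintype.linearCombination R v, ?_, fun x hx i => ?_⟩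
  · rw [← LinearMap.range_eq_top, Fintype.range_linearCombination, hspan]
  · have h1 : ∑ i, residue R (x i) • B i = 0 := by
      rw [← (TensorProduct.mk R k M 1).map_zero, ← hx, Fintype.linearCombination_apply, map_sum]
      refine Finset.sum_congr rfl fun i _ => ?_
      rw [map_smul, hv]
      exact IsScalarTower.algebraMap_smul k (x i) (B i)
    exact (residue_eq_zero_iff _).mp (Fintype.linearIndependent_iff.mp B.linearIndependent _ h1 i)

lemma exists_zero_eq [IsLocalRing R] [IsNoetherianRing R] (X : ModuleCat.{u} R)
    [Module.Finite R X] : ∃ C : MinimalSyzygySequence R, C.M 0 = X := by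
  choose b π hπ hmin using
    fun Z : {Z : ModuleCat.{u} R // Module.Finite R Z} =>
      have := Z.2
      exists_minimal_cover (R := R) Z.1
  let M : ℕ → {Z : ModuleCat.{u} R // Module.Finite R Z} := fun n => Nat.rec ⟨X, inferInstance⟩
    (fun _ Z => ⟨ModuleCat.of R (LinearMap.ker (π Z)), inferInstanceAs
      (Module.Finite R (LinearMap.ker (π Z)))⟩) n
  exact ⟨⟨fun j => (M j).1, fun j => b (M j), fun j => (LinearMap.ker (π (M j))).subtype,
    fun j => π (M j), fun j => Submodule.subtype_injective _, fun j =>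
    LinearMap.exact_subtype_ker_map _, fun j => hπ _, fun j x i => hmin _ _ x.2 i⟩, rfl⟩

variable [IsLocalRing R] (C : MinimalSyzygySequence R)

/-- The short complex `M (j + 1) → R ^ b j → M j`. -/
noncomputable abbrev shortComplex (j : ℕ) : ShortComplex (ModuleCat.{u} R) :=
  ModuleCat.shortComplexOfCompEqZero (C.ι j) (C.π j) (C.exact j).linearMap_comp_eq_zero

lemma shortExact (j : ℕ) : (C.shortComplex j).ShortExact :=
  ModuleCat.shortComplex_shortExact _ (C.exact j) (C.injective_ι j) (C.surjective_π j)

lemma exists_hasProjectiveDimensionLT (j : ℕ) (h : C.b j = 0) :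
    ∃ n, HasProjectiveDimensionLT (C.M 0) n := by
  have key : ∀ m l, l + m = j → HasProjectiveDimensionLT (C.M l) (m + 1) := by
    intro m
    induction m with
    | zero =>
      rintro l rfl
      have : IsEmpty (Fin (C.b l)) := by
        rw [add_zero] at h
        rw [h]
        infer_instance
      have : Subsingleton (C.M l) := (C.surjective_π l).subsingleton
      have := (ModuleCat.isZero_of_subsingleton (C.M l)).hasProjectiveDimensionLT_zero
      exact hasProjectiveDimensionLT_of_ge _ 0 _ (Nat.zero_le _)
    | succ m ih =>
      intro l hl
      exact (C.shortExact l).hasProjectiveDimensionLT_X₃ (m + 1) (ih (l + 1) (by lia))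
        inferInstance
  exact ⟨_, key j 0 (zero_add j)⟩

end MinimalSyzygySequence

end Resolutions

/-! ### Factoring linear maps through exact sequences; retracts of injectives. -/

section LinearAlgebra

variable {R : Type u} [CommRing R]

lemma LinearMap.exists_comp_eq_of_surjective {A B C X : Type*} [AddCommGroup A] [AddCommGroup B]
    [AddCommGroup C] [AddCommGroup X] [Module R A] [Module R B] [Module R C] [Module R X]
    {f : A →ₗ[R] B} {g : B →ₗ[R] C} (hfg : Function.Exact f g) (hg : Function.Surjective g)
    (h : B →ₗ[R] X) (hf : h ∘ₗ f = 0) : ∃ h' : C →ₗ[R] X, h' ∘ₗ g = h := by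
  have hle : LinearMap.ker g ≤ LinearMap.ker h := fun b hb => by
    obtain ⟨a, rfl⟩ := (hfg b).mp hb
    exact LinearMap.congr_fun hf a
  refine ⟨(LinearMap.ker g).liftQ h hle ∘ₗ (g.quotKerEquivOfSurjective hg).symm, ?_⟩
  ext b
  have : (g.quotKerEquivOfSurjective hg).symm (g b) = Submodule.Quotient.mk b :=
    (LinearEquiv.symm_apply_eq _).mpr rfl
  simp [this]

lemma LinearMap.exists_comp_eq_of_injective {A B C X : Type*} [AddCommGroup A] [AddCommGroup B]
    [AddCommGroup C] [AddCommGroup X] [Module R A] [Module R B] [Module R C] [Module R X]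
    {f : A →ₗ[R] B} {g : B →ₗ[R] C} (hfg : Function.Exact f g) (hf : Function.Injective f)
    (h : X →ₗ[R] B) (hg : g ∘ₗ h = 0) : ∃ h' : X →ₗ[R] A, f ∘ₗ h' = h := by
  have hle : ∀ x, h x ∈ LinearMap.range f := fun x => (hfg _).mp (LinearMap.congr_fun hg x)
  refine ⟨(LinearEquiv.ofInjective f hf).symm ∘ₗ h.codRestrict _ hle, ?_⟩
  ext x
  have := (LinearEquiv.ofInjective f hf).apply_symm_apply (h.codRestrict _ hle x)
  exact congrArg Subtype.val this

lemma Module.Injective.of_retract {P A : Type u} [AddCommGroup P] [AddCommGroup A] [Module R P]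
    [Module R A] [Module.Injective R P] (i : A →ₗ[R] P) (p : P →ₗ[R] A) (h : p ∘ₗ i = .id) :
    Module.Injective R A where
  out X Y _ _ _ _ f hf g := by
    obtain ⟨l, hl⟩ := Module.Injective.out f hf (i ∘ₗ g)
    exact ⟨p ∘ₗ l, fun x => by simpa [hl] using LinearMap.congr_fun h (g x)⟩

lemma LinearMap.apply_eq_zero_of_forall_mem {I : Ideal R} {n : ℕ} {X : Type*} [AddCommGroup X]
    [Module R X] (h : (Fin n → R) →ₗ[R] X) (hh : ∀ r ∈ I, r • h = 0) (x : Fin n → R)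
    (hx : ∀ i, x i ∈ I) : h x = 0 := by
  rw [LinearMap.pi_apply_eq_sum_univ]
  exact Finset.sum_eq_zero fun i _ => LinearMap.congr_fun (hh _ (hx i)) _

end LinearAlgebra

/-! ### The total complex of Hom(F, E) and its exactness in positive degrees. -/

section TotalComplex

variable {R : Type u} [CommRing R]

/-- The differential of an injective resolution. -/
noncomputable def CosyzygySequence.δ (E : CosyzygySequence R) (q : ℕ) :
    E.I q →ₗ[R] E.I (q + 1) :=
  E.ι (q + 1) ∘ₗ E.π q

lemma CosyzygySequence.δ_comp_δ (E : CosyzygySequence R) (q : ℕ) :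
    E.δ (q + 1) ∘ₗ E.δ q = 0 := by
  refine LinearMap.ext fun x => ?_
  simp [δ, (E.exact (q + 1)).apply_apply_eq_zero]

variable [IsLocalRing R]

/-- The differential of a minimal free resolution. -/
noncomputable def MinimalSyzygySequence.d (F : MinimalSyzygySequence R) (j : ℕ) :
    (Fin (F.b (j + 1)) → R) →ₗ[R] (Fin (F.b j) → R) :=
  F.ι j ∘ₗ F.π (j + 1)

lemma MinimalSyzygySequence.d_mem (F : MinimalSyzygySequence R) (j : ℕ) (x) (i) :
    F.d j x i ∈ maximalIdeal R :=
  F.minimal j _ i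

lemma MinimalSyzygySequence.d_comp_d (F : MinimalSyzygySequence R) (j : ℕ) :
    F.d j ∘ₗ F.d (j + 1) = 0 := by
  refine LinearMap.ext fun x => ?_
  simp [d, (F.exact (j + 1)).apply_apply_eq_zero]

lemma MinimalSyzygySequence.comp_ι_eq_zero (F : MinimalSyzygySequence R) (j : ℕ) {X : Type*}
    [AddCommGroup X] [Module R X] (h : (Fin (F.b j) → R) →ₗ[R] X) (hh : h ∘ₗ F.d j = 0) :
    h ∘ₗ F.ι j = 0 := by
  ext x
  obtain ⟨y, rfl⟩ := F.surjective_π (j + 1) x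
  exact LinearMap.congr_fun hh y

lemma MinimalSyzygySequence.exists_comp_d_eq (F : MinimalSyzygySequence R) (j : ℕ) {X : Type u}
    [AddCommGroup X] [Module R X] [Module.Injective R X] (h : (Fin (F.b (j + 1)) → R) →ₗ[R] X)
    (hh : h ∘ₗ F.d (j + 1) = 0) : ∃ g : (Fin (F.b j) → R) →ₗ[R] X, g ∘ₗ F.d j = h := by
  obtain ⟨h', rfl⟩ := LinearMap.exists_comp_eq_of_surjective (F.exact (j + 1))
    (F.surjective_π (j + 1)) h (F.comp_ι_eq_zero _ h hh)
  obtain ⟨g, hg⟩ := Module.Injective.out (F.ι j) (F.injective_ι j) h'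
  exact ⟨g, LinearMap.ext fun x => hg _⟩

namespace HomComplex

variable (F : MinimalSyzygySequence R) (E : CosyzygySequence R)

/-- Families of homomorphisms from the terms of `F` to the terms of `E`. -/
abbrev Family : Type u := ∀ j q : ℕ, (Fin (F.b j) → R) →ₗ[R] E.I q

variable {F E}

/-- Precomposition with the differential of `F`. -/
noncomputable def precompD (f : Family F E) : Family F E
  | 0, _ => 0
  | j + 1, q => f j q ∘ₗ F.d j

/-- Postcomposition with the differential of `E`. -/
noncomputable def postcompδ (f : Family F E) : Family F E
  | _, 0 => 0
  | j, q + 1 => E.δ q ∘ₗ f j q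

variable (F E) in
/-- The differential of the total complex. -/
noncomputable def differential : Family F E →ₗ[R] Family F E where
  toFun f j q := postcompδ f j q + (-1 : R) ^ q • precompD f j q
  map_add' f g := by
    funext j q
    cases j <;> cases q <;>
      simp [postcompδ, precompD, LinearMap.comp_add, LinearMap.add_comp]
    abel
  map_smul' r f := by
    funext j q
    cases j <;> cases q <;>
      simp [postcompδ, precompD, LinearMap.comp_smul, LinearMap.smul_comp, smul_comm _ r]

lemma differential_apply (f : Family F E) (j q : ℕ) :
    differential F E f j q = postcompδ f j q + (-1 : R) ^ q • precompD f j q := rfl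

lemma differential_differential (f : Family F E) :
    differential F E (differential F E f) = 0 := by
  have hd (j : ℕ) (x) : F.d j (F.d (j + 1) x) = 0 := LinearMap.congr_fun (F.d_comp_d j) x
  have hδ (q : ℕ) (x) : E.δ (q + 1) (E.δ q x) = 0 := LinearMap.congr_fun (E.δ_comp_δ q) x
  funext j q
  refine LinearMap.ext fun x => ?_
  rcases j with _ | _ | j <;> rcases q with _ | _ | q <;>
    simp [differential_apply, postcompδ, precompD, hd, hδ, pow_succ]

variable (F E) in
/-- The families concentrated in total degree `n`. -/
def degree (n : ℕ) : Submodule R (Family F E) where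
  carrier := {f | ∀ j q, j + q ≠ n → f j q = 0}
  zero_mem' _ _ _ := rfl
  add_mem' hf hg j q h := by simp [hf j q h, hg j q h]
  smul_mem' r f hf j q h := by simp [hf j q h]

lemma differential_mem_degree {n : ℕ} {f : Family F E} (hf : f ∈ degree F E n) :
    differential F E f ∈ degree F E (n + 1) := by
  intro j q h
  have h1 : postcompδ f j q = 0 := by
    cases q with
    | zero => rfl
    | succ q => rw [postcompδ, hf j q (by lia), LinearMap.comp_zero]
  have h2 : precompD f j q = 0 := by
    cases j with
    | zero => rfl
    | succ j => rw [precompD, hf j q (by lia), LinearMap.zero_comp]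
  rw [differential_apply, h1, h2, smul_zero, add_zero]

lemma injective_degree (n : ℕ) : Module.Injective R (degree F E n) := by
  have h1 (j q : ℕ) : Module.Injective R ((Fin (F.b j) → R) →ₗ[R] E.I q) :=
    have := E.injective q
    Module.Injective.of_ringEquiv (M := Fin (F.b j) → E.I q) (RingEquiv.refl R)
      (LinearEquiv.piRing R (E.I q) (Fin (F.b j)) R).symm
  -- Zeroing the entries off total degree n makes the degree n part a retract of a product of
  -- injectives.
  let p : Family F E →ₗ[R] Family F E :=
    { toFun f j q := if j + q = n then f j q else 0
      map_add' f g := by funext j q; by_cases h : j + q = n <;> simp [h]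
      map_smul' r f := by funext j q; by_cases h : j + q = n <;> simp [h] }
  refine .of_retract (degree F E n).subtype (p.codRestrict _ fun f j q h => if_neg h) ?_
  refine LinearMap.ext fun f => Subtype.ext (funext₂ fun j q => ?_)
  by_cases h : j + q = n
  · exact if_pos h
  · exact (if_neg h).trans (f.2 j q h).symm

/-- Columns are removed from the right: exactness of Hom(F, E q) moves the last nonzero column one
step left modulo a boundary. A cycle left in column 0 comes from a map M 0 → N (n + 1), which
`hlift` lifts to the preceding injective. -/
lemma exists_differential_eq_of_bound (n : ℕ)
    (hlift : ∀ q (φ : F.M 0 →ₗ[R] E.N (q + 1)), ∃ ψ : F.M 0 →ₗ[R] E.I q, E.π q ∘ₗ ψ = φ)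
    (s : ℕ) (f : Family F E) (hf : f ∈ degree F E (n + 1)) (hDf : differential F E f = 0)
    (hs : ∀ j q, s ≤ j → f j q = 0) : ∃ g ∈ degree F E n, differential F E g = f := by
  induction s using Nat.twoStepInduction generalizing f with
  | zero =>
    exact ⟨0, zero_mem _, by rw [map_zero]; funext j q; exact (hs j q (Nat.zero_le _)).symm⟩
  | one =>
    have h1 : f 0 (n + 1) ∘ₗ F.d 0 = 0 := by
      have := congrFun (congrFun hDf 1) (n + 1)
      rw [differential_apply, postcompδ, precompD, hs 1 n le_rfl, LinearMap.comp_zero,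
        zero_add] at this
      exact ((isUnit_neg_one.pow _).smul_eq_zero).mp this
    obtain ⟨φ, hφ⟩ := LinearMap.exists_comp_eq_of_surjective (F.exact 0) (F.surjective_π 0) _
      (F.comp_ι_eq_zero _ _ h1)
    have h2 : E.π (n + 1) ∘ₗ φ = 0 := by
      have := congrFun (congrFun hDf 0) (n + 1 + 1)
      rw [differential_apply, postcompδ, precompD, smul_zero, add_zero, ← hφ] at this
      ext x
      obtain ⟨y, rfl⟩ := F.surjective_π 0 x
      apply E.injective_ι (n + 1 + 1)
      rw [LinearMap.zero_apply, map_zero]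
      exact LinearMap.congr_fun this y
    obtain ⟨χ, hχ⟩ := LinearMap.exists_comp_eq_of_injective (E.exact (n + 1))
      (E.injective_ι (n + 1)) φ h2
    obtain ⟨ψ, hψ⟩ := hlift n χ
    refine ⟨Pi.single 0 (Pi.single n (ψ ∘ₗ F.π 0)), ?_, ?_⟩
    · intro j q h
      rcases j with _ | j
      · rw [Pi.single_eq_same, Pi.single_eq_of_ne (by lia)]
      · rw [Pi.single_eq_of_ne (by lia)]
        rfl
    · funext j q
      rw [differential_apply]
      rcases j with _ | _ | j
      · rw [precompD, smul_zero, add_zero]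
        rcases q with _ | q
        · exact (hf 0 0 (by lia)).symm
        · rw [postcompδ, Pi.single_eq_same]
          by_cases hq : q = n
          · subst hq
            rw [Pi.single_eq_same, ← hφ, ← hχ, ← hψ]
            rfl
          · rw [Pi.single_eq_of_ne hq, LinearMap.comp_zero, hf 0 (q + 1) (by lia)]
      · rw [hs _ q (by lia), precompD, Pi.single_eq_same]
        have hz : ∀ q, (Pi.single n (ψ ∘ₗ F.π 0) : ∀ q, (Fin (F.b 0) → R) →ₗ[R] E.I q) q ∘ₗ
            F.d 0 = 0 := by
          intro q
          by_cases hq : q = n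
          · subst hq
            rw [Pi.single_eq_same]
            refine LinearMap.ext fun x => ?_
            simp [MinimalSyzygySequence.d, (F.exact 0).apply_apply_eq_zero]
          · rw [Pi.single_eq_of_ne hq, LinearMap.zero_comp]
        rw [hz, smul_zero, add_zero]
        rcases q with _ | q
        · rfl
        · rw [postcompδ, Pi.single_eq_of_ne (by lia)]
          exact LinearMap.comp_zero _
      · rw [hs _ q (by lia), precompD, Pi.single_eq_of_ne (by lia)]
        rcases q with _ | q
        · simp [postcompδ]
        · rw [postcompδ, Pi.single_eq_of_ne (by lia)]
          simp
  | more s _ ih =>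
    have h1 (q : ℕ) : f (s + 1) q ∘ₗ F.d (s + 1) = 0 := by
      have := congrFun (congrFun hDf (s + 1 + 1)) q
      have h0 : postcompδ f (s + 1 + 1) q = 0 := by
        cases q with
        | zero => rfl
        | succ q => rw [postcompδ, hs _ _ le_rfl, LinearMap.comp_zero]
      rw [differential_apply, h0, precompD, zero_add] at this
      exact ((isUnit_neg_one.pow _).smul_eq_zero).mp this
    have h2 (q : ℕ) : ∃ g : (Fin (F.b s) → R) →ₗ[R] E.I q,
        (-1 : R) ^ q • g ∘ₗ F.d s = f (s + 1) q ∧ (s + q ≠ n → g = 0) := by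
      have := E.injective q
      by_cases hq : s + q = n
      · obtain ⟨g, hg⟩ := F.exists_comp_d_eq s (f (s + 1) q) (h1 q)
        refine ⟨(-1 : R) ^ q • g, ?_, fun h => (h hq).elim⟩
        rw [LinearMap.smul_comp, smul_smul, ← mul_pow, hg]
        simp
      · exact ⟨0, by rw [hf (s + 1) q (by lia)]; simp, fun _ => rfl⟩
    choose G hG hG0 using h2
    -- Column s + 1 of the differential of `g` is that of `f`; the sign was absorbed into `G`.
    let g : Family F E := Pi.single s G
    have hg : g ∈ degree F E n := by
      intro j q h
      by_cases hj : j = s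
      · subst hj
        simpa [g] using hG0 q h
      · simp [g, hj]
    obtain ⟨g', hg', hDg'⟩ := ih (f - differential F E g)
      (sub_mem hf (differential_mem_degree hg))
      (by rw [map_sub, hDf, differential_differential, sub_zero]) (by
        intro j q hj
        obtain ⟨i, rfl⟩ : ∃ i, j = i + 1 := ⟨j - 1, by lia⟩
        have h0 : postcompδ g (i + 1) q = 0 := by
          cases q with
          | zero => rfl
          | succ q =>
            have : g (i + 1) = 0 := Pi.single_eq_of_ne (by lia) _
            rw [postcompδ, this]
            exact LinearMap.comp_zero _
        change f _ _ - differential F E g _ _ = 0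
        rw [differential_apply, h0, zero_add, precompD, sub_eq_zero]
        by_cases hi : i = s
        · subst hi
          rw [← hG q, show g i = G from Pi.single_eq_same _ _]
        · rw [hs _ q (by lia), show g i = 0 from Pi.single_eq_of_ne hi _]
          simp)
    exact ⟨g' + g, add_mem hg' hg, by rw [map_add, hDg', sub_add_cancel]⟩

lemma exists_differential_eq (n : ℕ)
    (hlift : ∀ q (φ : F.M 0 →ₗ[R] E.N (q + 1)), ∃ ψ : F.M 0 →ₗ[R] E.I q, E.π q ∘ₗ ψ = φ)
    (f : Family F E) (hf : f ∈ degree F E (n + 1)) (hDf : differential F E f = 0) :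
    ∃ g ∈ degree F E n, differential F E g = f :=
  exists_differential_eq_of_bound n hlift (n + 2) f hf hDf fun j q h => hf j q (by lia)

end HomComplex

end TotalComplex

/-! ### Cycles, socle families and vanishing of a Betti number. -/

namespace HomComplex

variable {R : Type u} [CommRing R] [IsLocalRing R]
variable (F : MinimalSyzygySequence R) (E : CosyzygySequence R)

/-- The cycles of total degree `n`. -/
noncomputable def cycles (n : ℕ) : Submodule R (Family F E) :=
  degree F E n ⊓ LinearMap.ker (differential F E)

variable {F E}

lemma mem_cycles {n : ℕ} {f : Family F E} :
    f ∈ cycles F E n ↔ f ∈ degree F E n ∧ differential F E f = 0 := Iff.rfl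

lemma cycles_le_degree (n : ℕ) : cycles F E n ≤ degree F E n := inf_le_left

variable (F E) in
/-- The differential, from families of degree `n` to cycles of degree `n + 1`. -/
noncomputable def toCycles (n : ℕ) : degree F E n →ₗ[R] cycles F E (n + 1) :=
  (differential F E ∘ₗ (degree F E n).subtype).codRestrict _ fun f =>
    ⟨differential_mem_degree f.2, differential_differential f.1⟩

lemma exact_toCycles (n : ℕ) :
    Function.Exact (Submodule.inclusion (cycles_le_degree (F := F) (E := E) n))
      (toCycles F E n) := by
  intro f
  constructor
  · intro h
    exact ⟨⟨f.1, f.2, congrArg Subtype.val h⟩, rfl⟩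
  · rintro ⟨g, rfl⟩
    exact Subtype.ext g.2.2

section Lift

variable (hlift : ∀ q (φ : F.M 0 →ₗ[R] E.N (q + 1)), ∃ ψ : F.M 0 →ₗ[R] E.I q, E.π q ∘ₗ ψ = φ)
include hlift

lemma surjective_toCycles (n : ℕ) : Function.Surjective (toCycles F E n) := by
  rintro ⟨f, hf, hDf⟩
  obtain ⟨g, hg, hDg⟩ := exists_differential_eq n hlift f hf hDf
  exact ⟨⟨g, hg⟩, Subtype.ext hDg⟩

lemma injective_cycles (c : ℕ)
    (hc : HasInjectiveDimensionLT (ModuleCat.of R (cycles F E 0)) (c + 1)) (n : ℕ) (hn : c ≤ n) :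
    Module.Injective R (cycles F E n) := by
  -- Each sequence 0 → Z^n → D^n → Z^{n+1} → 0 with D^n injective lowers the bound by one; truncated
  -- subtraction stops it at 1, which means injective.
  have key : ∀ n, HasInjectiveDimensionLT (ModuleCat.of R (cycles F E n)) (c - n + 1) := by
    intro n
    induction n with
    | zero => exact hc
    | succ n ih =>
      have := injective_degree (F := F) (E := E) n
      have := Module.injective_object_of_injective_module R (degree F E n)
      refine (ModuleCat.shortComplex_shortExact (ModuleCat.shortComplexOfCompEqZero _ _
        (exact_toCycles (F := F) (E := E) n).linearMap_comp_eq_zero) (exact_toCycles n)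
        (Submodule.inclusion_injective (cycles_le_degree n))
        (surjective_toCycles hlift n)).hasInjectiveDimensionLT_X₃ _ ?_ ?_
      · exact hasInjectiveDimensionLT_of_ge _ 1 _ (by lia)
      · exact hasInjectiveDimensionLT_of_ge _ (c - n + 1) _ (by lia)
  have := key n
  rw [Nat.sub_eq_zero_of_le hn] at this
  have := injective_iff_hasInjectiveDimensionLT_one.mpr this
  exact Module.injective_module_of_injective_object R _

/-- If the cycles of degree `n` form an injective module, then every cycle of degree `n + 1`
annihilated by an ideal is the differential of a family annihilated by that ideal. -/
lemma exists_differential_eq_of_annihilated (n : ℕ) [Module.Injective R (cycles F E n)]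
    (I : Ideal R) (X : Family F E) (hX : X ∈ cycles F E (n + 1)) (hIX : ∀ r ∈ I, r • X = 0) :
    ∃ Y : Family F E, differential F E Y = X ∧ ∀ r ∈ I, r • Y = 0 := by
  obtain ⟨Y, hY, hDY⟩ := exists_differential_eq n hlift X hX.1 hX.2
  obtain ⟨ρ, hρ⟩ := Module.Injective.out (Submodule.inclusion (cycles_le_degree n))
    (Submodule.inclusion_injective _) (LinearMap.id (M := cycles F E n))
  have hz : differential F E (ρ ⟨Y, hY⟩ : cycles F E n) = 0 := (ρ ⟨Y, hY⟩).2.2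
  -- Remove the cycle component of `Y`: for r in I the family rY is itself a cycle, hence fixed by
  -- the retraction `ρ`.
  refine ⟨Y - (ρ ⟨Y, hY⟩ : cycles F E n), by rw [map_sub, hDY, hz, sub_zero], fun r hr => ?_⟩
  have h1 : r • Y ∈ cycles F E n := mem_cycles.mpr ⟨Submodule.smul_mem _ _ hY, by
    rw [map_smul, hDY, hIX r hr]⟩
  have h2 : r • ρ ⟨Y, hY⟩ = ⟨r • Y, h1⟩ := by
    rw [← map_smul]
    exact hρ ⟨r • Y, h1⟩
  rw [smul_sub, sub_eq_zero]
  exact (congrArg Subtype.val h2).symm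

end Lift

/-- Homomorphisms `M 0 → N 0` as families. -/
noncomputable def augment (χ : F.M 0 →ₗ[R] E.N 0) : Family F E
  | 0, 0 => E.ι 0 ∘ₗ χ ∘ₗ F.π 0
  | 0, _ + 1 => 0
  | _ + 1, _ => 0

lemma augment_mem_cycles (χ : F.M 0 →ₗ[R] E.N 0) : augment χ ∈ cycles F E 0 := by
  refine mem_cycles.mpr ⟨?_, ?_⟩
  · intro j q h
    rcases j with _ | j <;> rcases q with _ | q <;> first | rfl | exact (h rfl).elim
  · funext j q
    refine LinearMap.ext fun x => ?_
    rcases j with _ | _ | j <;> rcases q with _ | _ | q <;>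
      simp [differential_apply, postcompδ, precompD, augment, MinimalSyzygySequence.d,
        CosyzygySequence.δ, (F.exact 0).apply_apply_eq_zero, (E.exact 0).apply_apply_eq_zero]

variable (F E) in
/-- Homomorphisms `M 0 → N 0` are the cycles of degree zero. -/
noncomputable def augmentLinearMap : (F.M 0 →ₗ[R] E.N 0) →ₗ[R] cycles F E 0 where
  toFun χ := ⟨augment χ, augment_mem_cycles χ⟩
  map_add' χ ψ := by
    refine Subtype.ext (funext₂ fun j q => LinearMap.ext fun x => ?_)
    rcases j with _ | j <;> rcases q with _ | q <;> simp [augment]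
  map_smul' r χ := by
    refine Subtype.ext (funext₂ fun j q => LinearMap.ext fun x => ?_)
    rcases j with _ | j <;> rcases q with _ | q <;> simp [augment]

lemma bijective_augmentLinearMap : Function.Bijective (augmentLinearMap F E) := by
  constructor
  · rw [injective_iff_map_eq_zero]
    intro χ hχ
    have h := congrFun (congrFun (congrArg Subtype.val hχ) 0) 0
    ext x
    obtain ⟨y, rfl⟩ := F.surjective_π 0 x
    apply E.injective_ι 0
    rw [LinearMap.zero_apply, map_zero]
    exact LinearMap.congr_fun h y
  · rintro ⟨f, hf, hDf⟩
    replace hDf : differential F E f = 0 := hDf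
    have h1 : f 0 0 ∘ₗ F.d 0 = 0 := by
      have := congrFun (congrFun hDf 1) 0
      rwa [differential_apply, postcompδ, precompD, pow_zero, one_smul, zero_add] at this
    obtain ⟨φ, hφ⟩ := LinearMap.exists_comp_eq_of_surjective (F.exact 0) (F.surjective_π 0) _
      (F.comp_ι_eq_zero _ _ h1)
    have h2 : E.π 0 ∘ₗ φ = 0 := by
      have := congrFun (congrFun hDf 0) 1
      rw [differential_apply, postcompδ, precompD, smul_zero, add_zero, ← hφ] at this
      ext x
      obtain ⟨y, rfl⟩ := F.surjective_π 0 x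
      apply E.injective_ι 1
      rw [LinearMap.zero_apply, map_zero]
      exact LinearMap.congr_fun this y
    obtain ⟨χ, hχ⟩ := LinearMap.exists_comp_eq_of_injective (E.exact 0) (E.injective_ι 0) φ h2
    refine ⟨χ, Subtype.ext (funext₂ fun j q => ?_)⟩
    rcases j with _ | j <;> rcases q with _ | q
    · change E.ι 0 ∘ₗ χ ∘ₗ F.π 0 = f 0 0
      rw [← hφ, ← hχ, LinearMap.comp_assoc]
    all_goals exact (hf _ _ (by lia)).symm

/-- By minimality, the differential of F has entries in the maximal ideal, which kills Y. -/
lemma precompD_eq_zero (Y : Family F E) (hY : ∀ r ∈ maximalIdeal R, r • Y = 0) (j q : ℕ) :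
    precompD Y j q = 0 := by
  cases j with
  | zero => rfl
  | succ j =>
    exact LinearMap.ext fun x => LinearMap.apply_eq_zero_of_forall_mem (I := maximalIdeal R) _
      (fun r hr => congrFun (congrFun (hY r hr) j) q) _ (F.d_mem j x)

/-- The family sending one basis vector of degree `j` to `v`. -/
noncomputable def coordinate (j t : ℕ) (i : Fin (F.b j)) (v : E.N t) : Family F E :=
  Pi.single j (Pi.single t (LinearMap.toSpanSingleton R (E.I t) (E.ι t v) ∘ₗ LinearMap.proj i))

lemma coordinate_self (j t : ℕ) (i : Fin (F.b j)) (v : E.N t) :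
    coordinate (F := F) j t i v j t =
      LinearMap.toSpanSingleton R (E.I t) (E.ι t v) ∘ₗ LinearMap.proj i := by
  rw [coordinate, Pi.single_eq_same, Pi.single_eq_same]

lemma coordinate_of_ne (j t : ℕ) (i : Fin (F.b j)) (v : E.N t) (j' t' : ℕ)
    (h : j' ≠ j ∨ t' ≠ t) : coordinate (F := F) j t i v j' t' = 0 := by
  rw [coordinate]
  by_cases hj : j' = j
  · subst hj
    rw [Pi.single_eq_same, Pi.single_eq_of_ne (h.resolve_left (by simp))]
  · rw [Pi.single_eq_of_ne hj]
    rfl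

lemma smul_coordinate (j t : ℕ) (i : Fin (F.b j)) (v : E.N t)
    (hv : ∀ r ∈ maximalIdeal R, r • v = 0) (r : R) (hr : r ∈ maximalIdeal R) :
    r • coordinate (F := F) j t i v = 0 := by
  funext j' t'
  by_cases h : j' = j ∧ t' = t
  · obtain ⟨rfl, rfl⟩ := h
    rw [Pi.smul_apply, Pi.smul_apply, coordinate_self]
    refine LinearMap.ext fun x => ?_
    change r • x i • E.ι t' v = 0
    rw [smul_comm, ← map_smul, hv r hr, map_zero, smul_zero]
  · rw [Pi.smul_apply, Pi.smul_apply, coordinate_of_ne j t i v j' t' (by tauto), smul_zero]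
    rfl

lemma coordinate_mem_cycles (j t : ℕ) (i : Fin (F.b j)) (v : E.N t)
    (hv : ∀ r ∈ maximalIdeal R, r • v = 0) :
    coordinate (F := F) j t i v ∈ cycles F E (j + t) := by
  refine mem_cycles.mpr ⟨fun j' t' h => coordinate_of_ne j t i v j' t' (by lia), ?_⟩
  funext j' t'
  rw [differential_apply, precompD_eq_zero _ (smul_coordinate j t i v hv), smul_zero, add_zero]
  cases t' with
  | zero => rfl
  | succ t' =>
    rw [postcompδ]
    by_cases h : j' = j ∧ t' = t
    · obtain ⟨rfl, rfl⟩ := h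
      rw [coordinate_self]
      refine LinearMap.ext fun x => ?_
      simp [CosyzygySequence.δ, (E.exact t').apply_apply_eq_zero]
    · rw [coordinate_of_ne j t i v j' t' (by tauto), LinearMap.comp_zero]
      rfl

/-- If `Hom(M, N)` has finite injective dimension and `Ext` from `M` to `N` vanishes in positive
degrees, then the minimal free resolution of `M` is bounded. -/
theorem exists_betti_eq_zero [IsNoetherianRing R] [Module.Finite R (E.N 0)] [Nontrivial (E.N 0)]
    (hExt : ∀ i, Subsingleton (Ext.{u} (F.M 0) (E.N 0) (i + 1)))
    (c : ℕ) (hc : HasInjectiveDimensionLT (ModuleCat.of R (F.M 0 →ₗ[R] E.N 0)) (c + 1)) :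
    ∃ j, F.b j = 0 := by
  have hlift := E.exists_lift (F.M 0) hExt
  have hc' : HasInjectiveDimensionLT (ModuleCat.of R (cycles F E 0)) (c + 1) :=
    hasInjectiveDimensionLT_of_iso (LinearEquiv.ofBijective _
      bijective_augmentLinearMap : (F.M 0 →ₗ[R] E.N 0) ≃ₗ[R] cycles F E 0).toModuleIso _
  have key (j t m : ℕ) (hm : c ≤ m) (hjt : j + t = m + 1) (i : Fin (F.b j)) (v : E.N t)
      (hv : ∀ r ∈ maximalIdeal R, r • v = 0) :
      ∃ Y : Family F E, (∀ r ∈ maximalIdeal R, r • Y = 0) ∧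
        postcompδ Y j t (Pi.single i 1) = E.ι t v := by
    have := injective_cycles hlift c hc' m hm
    obtain ⟨Y, hDY, hY⟩ := exists_differential_eq_of_annihilated hlift m (maximalIdeal R) _
      (hjt ▸ coordinate_mem_cycles j t i v hv) (smul_coordinate j t i v hv)
    refine ⟨Y, hY, ?_⟩
    have h := congrFun (congrFun hDY j) t
    rw [differential_apply, precompD_eq_zero _ hY, smul_zero, add_zero, coordinate_self] at h
    rw [h]
    simp
  by_contra! hb
  have i (j : ℕ) : Fin (F.b j) := ⟨0, Nat.pos_of_ne_zero (hb j)⟩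
  rcases E.exists_socle_element with ⟨v, hv0, hv⟩ | ⟨q, v, hv, hvy⟩
  -- In row 0 nothing comes from E, so `postcompδ` is 0 there and v must vanish.
  · obtain ⟨Y, -, hY⟩ := key (c + 1) 0 c le_rfl rfl (i _) v hv
    refine hv0 (E.injective_ι 0 ?_)
    rw [map_zero, ← hY]
    rfl
  -- The value of Y c q at the basis vector is a socle element of I q lifting v.
  · obtain ⟨Y, hmY, hY⟩ := key c (q + 1) (c + q) (by lia) rfl (i _) v hv
    refine hvy (Y c q (Pi.single (i _) 1)) (fun r hr => ?_) (E.injective_ι (q + 1) hY)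
    exact LinearMap.congr_fun (congrFun (congrFun (hmY r hr) c) q) _

end HomComplex

/-! ### Finite injective dimension of Ext passes to syzygies. -/

section SyzygyReduction

variable {R : Type u} [CommRing R]

lemma hasInjectiveDimensionLT_of_linearEquiv {A B : Type u} [AddCommGroup A] [AddCommGroup B]
    [Module R A] [Module R B] (e : A ≃ₗ[R] B) {n : ℕ}
    (h : HasInjectiveDimensionLT (ModuleCat.of R A) n) :
    HasInjectiveDimensionLT (ModuleCat.of R B) n :=
  hasInjectiveDimensionLT_of_iso e.toModuleIso n

lemma hasInjectiveDimensionLT_pi {N : Type u} [AddCommGroup N] [Module R N] {n : ℕ}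
    (h : HasInjectiveDimensionLT (ModuleCat.of R N) n) (b : ℕ) :
    HasInjectiveDimensionLT (ModuleCat.of R (Fin b → N)) n := by
  induction b with
  | zero =>
    have := (ModuleCat.isZero_of_subsingleton
      (ModuleCat.of R (Fin 0 → N))).hasInjectiveDimensionLT_zero
    exact hasInjectiveDimensionLT_of_ge _ 0 _ (Nat.zero_le _)
  | succ b ih =>
    have hex : Function.Exact (LinearMap.inl R N (Fin b → N)) (LinearMap.snd R N (Fin b → N)) :=
      Function.Exact.inl_snd
    have h2 := (ModuleCat.shortComplex_shortExact (ModuleCat.shortComplexOfCompEqZero _ _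
      hex.linearMap_comp_eq_zero) hex LinearMap.inl_injective
      LinearMap.snd_surjective).hasInjectiveDimensionLT_X₂ n h ih
    exact hasInjectiveDimensionLT_of_linearEquiv (Fin.consLinearEquiv R fun _ => N) h2

/-- In an exact sequence `0 → A → B → C → D → 0`, if `A`, `B` and `D` have finite injective
dimension, so has `C`. -/
lemma exists_hasInjectiveDimensionLT_of_exact {A B C D : Type u} [AddCommGroup A] [AddCommGroup B]
    [AddCommGroup C] [AddCommGroup D] [Module R A] [Module R B] [Module R C] [Module R D]
    (f : A →ₗ[R] B) (g : B →ₗ[R] C) (h : C →ₗ[R] D) (hf : Function.Injective f)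
    (hfg : Function.Exact f g) (hgh : Function.Exact g h) (hh : Function.Surjective h)
    (hA : ∃ n, HasInjectiveDimensionLT (ModuleCat.of R A) n)
    (hB : ∃ n, HasInjectiveDimensionLT (ModuleCat.of R B) n)
    (hD : ∃ n, HasInjectiveDimensionLT (ModuleCat.of R D) n) :
    ∃ n, HasInjectiveDimensionLT (ModuleCat.of R C) n := by
  obtain ⟨a, hA⟩ := hA
  obtain ⟨b, hB⟩ := hB
  obtain ⟨d, hD⟩ := hD
  let n := a + b + d
  have hA' := hasInjectiveDimensionLT_of_ge (ModuleCat.of R A) a (n + 1) (by lia)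
  have hB' := hasInjectiveDimensionLT_of_ge (ModuleCat.of R B) b n (by lia)
  have hD' := hasInjectiveDimensionLT_of_ge (ModuleCat.of R D) d n (by lia)
  have e₁ : Function.Exact f g.rangeRestrict := fun x => by
    rw [← hfg x, Subtype.ext_iff]
    rfl
  have e₂ : Function.Exact (LinearMap.range g).subtype h := fun x => by
    rw [hgh x]
    simp
  have hR := (ModuleCat.shortComplex_shortExact (ModuleCat.shortComplexOfCompEqZero _ _
    e₁.linearMap_comp_eq_zero) e₁ hf g.surjective_rangeRestrict).hasInjectiveDimensionLT_X₃ n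
    hB' hA'
  exact ⟨n, (ModuleCat.shortComplex_shortExact (ModuleCat.shortComplexOfCompEqZero _ _
    e₂.linearMap_comp_eq_zero) e₂ (Submodule.subtype_injective _) hh).hasInjectiveDimensionLT_X₂ n
    hR hD'⟩

variable {S : ShortComplex (ModuleCat.{u} R)} (hS : S.ShortExact) (N : ModuleCat.{u} R)
include hS

/-- The connecting homomorphisms out of `Ext` of a syzygy module are bijective in positive
degrees. -/
lemma bijective_precompOfLinear_extClass [Projective S.X₂] (i : ℕ) :
    Function.Bijective (hS.extClass.precompOfLinear R N (add_comm 1 (i + 1))) := by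
  refine ⟨?_, precomp_extClass_surjective_of_projective_X₂ N hS (i + 1)⟩
  rw [injective_iff_map_eq_zero]
  intro x hx
  obtain ⟨y, rfl⟩ := Ext.contravariant_sequence_exact₁ hS N x (add_comm 1 (i + 1)) hx
  rw [Ext.eq_zero_of_projective y, Ext.comp_zero]

/-- Degree 0 uses 0 → Hom(X₃, N) → Hom(X₂, N) → Hom(X₁, N) → Ext^1(X₃, N) → 0; higher degrees are
dimension shifting. -/
lemma exists_hasInjectiveDimensionLT_ext_syzygy [Projective S.X₂]
    (h₂ : ∃ n, HasInjectiveDimensionLT (ModuleCat.of R (Ext.{u} S.X₂ N 0)) n)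
    (h₃ : ∀ i, ∃ n, HasInjectiveDimensionLT (ModuleCat.of R (Ext.{u} S.X₃ N i)) n) (i : ℕ) :
    ∃ n, HasInjectiveDimensionLT (ModuleCat.of R (Ext.{u} S.X₁ N i)) n := by
  cases i with
  | zero =>
    have := hS.epi_g
    refine exists_hasInjectiveDimensionLT_of_exact
      ((Ext.mk₀ S.g).precompOfLinear R N (zero_add 0))
      ((Ext.mk₀ S.f).precompOfLinear R N (zero_add 0))
      (hS.extClass.precompOfLinear R N (add_comm 1 0))
      (Ext.precomp_mk₀_injective_of_epi N S.g) (fun x => ⟨fun hx => ?_, ?_⟩)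
      (fun x => ⟨fun hx => ?_, ?_⟩)
      (precomp_extClass_surjective_of_projective_X₂ N hS 0) (h₃ 0) h₂ (h₃ 1)
    · exact Ext.contravariant_sequence_exact₂ hS N x hx
    · rintro ⟨y, rfl⟩
      simp
    · exact Ext.contravariant_sequence_exact₁ hS N x (add_comm 1 0) hx
    · rintro ⟨y, rfl⟩
      simp
  | succ i =>
    obtain ⟨n, hn⟩ := h₃ (i + 1 + 1)
    exact ⟨n, hasInjectiveDimensionLT_of_linearEquiv (LinearEquiv.ofBijective _
      (bijective_precompOfLinear_extClass hS N i)).symm hn⟩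

end SyzygyReduction

/-! ### Induction on the degree beyond which Ext vanishes, and the theorem. -/

theorem exists_hasProjectiveDimensionLT_of_ext {R : Type u} [CommRing R] [IsLocalRing R]
    [IsNoetherianRing R] (N : ModuleCat.{u} R) [Module.Finite R N] [Nontrivial N]
    (hN : ∃ n, HasInjectiveDimensionLT N n) (c : ℕ) (M : ModuleCat.{u} R) [Module.Finite R M]
    (hc : ∀ i, c ≤ i → Subsingleton (Ext.{u} M N (i + 1)))
    (hExt : ∀ i, ∃ n, HasInjectiveDimensionLT (ModuleCat.of R (Ext.{u} M N i)) n) :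
    ∃ n, HasProjectiveDimensionLT M n := by
  induction c generalizing M with
  | zero =>
    obtain ⟨F, rfl⟩ := MinimalSyzygySequence.exists_zero_eq M
    obtain ⟨E, rfl⟩ := CosyzygySequence.exists_zero_eq N
    obtain ⟨n, hn⟩ := hExt 0
    have hn' := hasInjectiveDimensionLT_of_ge (ModuleCat.of R (Ext.{u} (F.M 0) (E.N 0) 0)) n (n + 1)
      (by lia)
    obtain ⟨j, hj⟩ := HomComplex.exists_betti_eq_zero (F := F) (E := E)
      (fun i => hc i (Nat.zero_le i)) n
      (hasInjectiveDimensionLT_of_linearEquiv (Ext.linearEquiv₀.trans ModuleCat.homLinearEquiv) hn')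
    exact F.exists_hasProjectiveDimensionLT j hj
  | succ c ih =>
    -- Any finite free cover serves here; minimality matters only in the base case.
    obtain ⟨b, π, hπ⟩ := Module.Finite.exists_fin' R M
    have hS := LinearMap.shortExact_shortComplexKer hπ
    have hX₂ : ∃ n, HasInjectiveDimensionLT
        (ModuleCat.of R (Ext.{u} (ModuleCat.of R (Fin b → R)) N 0)) n := by
      obtain ⟨n, hn⟩ := hN
      exact ⟨n, hasInjectiveDimensionLT_of_linearEquiv ((Ext.linearEquiv₀.trans
        ModuleCat.homLinearEquiv).trans (LinearEquiv.piRing R N (Fin b) R)).symm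
        (hasInjectiveDimensionLT_pi hn b)⟩
    obtain ⟨n, hn⟩ := ih (ModuleCat.of R (LinearMap.ker π)) (fun i hi =>
      have := hc (i + 1) (by lia)
      (bijective_precompOfLinear_extClass hS N i).injective.subsingleton)
      (exists_hasInjectiveDimensionLT_ext_syzygy hS N hX₂ hExt)
    exact ⟨n + 1, hS.hasProjectiveDimensionLT_X₃ n hn
      (hasProjectiveDimensionLT_of_ge _ 1 _ (by lia))⟩

lemma exists_hasInjectiveDimensionLT_of_injectiveDimension_lt_top {R : Type u} [CommRing R]
    {X : ModuleCat.{u} R} (h : injectiveDimension X < ⊤) : ∃ n, HasInjectiveDimensionLT X n := by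
  obtain ⟨n, hn⟩ := (injectiveDimension_ne_top_iff X).mp h.ne
  exact ⟨n + 1, hn⟩

theorem mainTheorem3 (R : Type u) [CommRing R] [IsLocalRing R] [IsNoetherianRing R]
    (M : Type u) [AddCommGroup M] [Module R M] [Module.Finite R M]
    (N : Type u) [AddCommGroup N] [Module R N] [Module.Finite R N] [Nontrivial N]
    (hN : CategoryTheory.injectiveDimension (ModuleCat.of R N) < ⊤)
    (hdepth : ringKrullDim R ≤ (moduleDepth R N : WithBot ℕ∞) + 1)
    (hExt : ∀ i : ℕ, CategoryTheory.injectiveDimension (ModuleCat.of R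
      (CategoryTheory.Abelian.Ext.{u} (ModuleCat.of R M) (ModuleCat.of R N) i)) < ⊤) :
    CategoryTheory.projectiveDimension (ModuleCat.of R M) < ⊤ := by 
  have h i := exists_hasInjectiveDimensionLT_of_injectiveDimension_lt_top (hExt i)
  obtain ⟨n, hn⟩ := exists_hasInjectiveDimensionLT_of_injectiveDimension_lt_top hN
  obtain ⟨m, hm⟩ := exists_hasProjectiveDimensionLT_of_ext (ModuleCat.of R N) ⟨n, hn⟩ n
    (ModuleCat.of R M) (fun i hi => HasInjectiveDimensionLT.subsingleton _ n (i + 1) (by lia) _) h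
  exact ((projectiveDimension_lt_iff (n := m)).mpr hm).trans_le le_top
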